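/- **Theorem 3 (pluri-Lagrangian structure of the sine-Gordon equation).** *Setting.* For a field $u=u(x^1,\dots,x^n)$ and differential functions $L_{ij}[u]=L_{ij}(u,u_k,u_{km})$, $L_{ij}=-L_{ji}$, of its second jet ($u_{km}=u_{mk}$ being a single jet coordinate), put for $i\ne j$ $$\frac{\delta L_{ij}}{\delta u}=\frac{\partial L_{ij}}{\partial u}-D_i\frac{\partial L_{ij}}{\partial u_i}-D_j\frac{\partial L_{ij}}{\partial u_j}+D_i^2\frac{\partial L_{ij}}{\partial u_{ii}}+D_iD_j\frac{\partial L_{ij}}{\partial u_{ij}}+D_j^2\frac{\partial L_{ij}}{\partial u_{jj}},$$ $$\frac{\delta L_{ij}}{\delta u_k}=\frac{\partial L_{ij}}{\partial u_k}-D_i\frac{\partial L_{ij}}{\partial u_{ik}}-D_j\frac{\partial L_{ij}}{\partial u_{jk}},\qquad \frac{\delta L_{ij}}{\delta u_{km}}=\frac{\partial L_{ij}}{\partial u_{km}},$$ where $D_i$ is the total derivative with respect to $x^i$. The multi-time Euler–Lagrange equations of the 2-form $\sum_{i<j}L_{ij}[u]\,dx^i\wedge dx^j$ are the system 1. $\delta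 L_{ij}/\delta u=0$ for $i\neq j$; 2. $\delta L_{ij}/\delta u_k=0$ for $i\ne j$, $k\notin\{i,j\}$; 3. $\delta L_{ij}/\delta u_{km}=0$ for $i\ne j$, $k,m\notin\{i,j\}$; 4. $\delta L_{ij}/\delta u_j$ does not depend on $j\ne i$, for each $i$; 5. $\delta L_{ij}/\delta u_{jk}$ does not depend on $j\neq i$, for each $i$ and each $k\ne i$; 6. $\delta L_{ij}/\delta u_{ij}+\delta L_{jk}/\delta u_{jk}+\delta L_{ki}/\delta u_{ki}=0$ for distinct $i,j,k$. *Theorem.* Let $(x^1,x^2,x^3)=(x,y,z)$ and let $$\mathcal L=L[u]\,dx\wedge dy-M[u]\,dz\wedge dx-N[u]\,dy\wedge dz,$$ that is, $L_{12}=L$, $L_{13}=M$, $L_{23}=-N$, where $$L=\tfrac12u_xu_y-\cos u,\qquad M=\tfrac12u_xu_z-\tfrac18u_x^4+\tfrac12u_{xx}^2,\qquad N=\tfrac12u_yu_z-\tfrac12u_x^2\cos u-u_{xx}(u_{xy}-\sin u).$$ Let $u$ be a smooth real function on an open set $\Omega\subseteq\mathbb R^3$. Then: (a) $u$ satisfies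 the multi-time Euler–Lagrange equations of $\mathcal L$ on $\Omega$ if and only if it satisfies on $\Omega$ both the sine-Gordon equation $u_{xy}=\sin u$ and the modified KdV equation $u_z=u_{xxx}+\tfrac12u_x^3$. (b) If $u$ satisfies these two equations on $\Omega$, then $\mathcal L$ is closed on $\Omega$. (c) For every smooth $u$, whether or not it satisfies any equation, $$D_zL-(D_yM+D_xN)=-\Big(u_z-\tfrac12u_x^3-u_{xxx}\Big)(u_{xy}-\sin u)\quad\text{on }\Omega .$$ -/

import Mathlib

open scoped ContDiff

namespace PluriLagrangian

/-- The multi-time: `ℝⁿ` with coordinates `x^1, …, x^n` (here indexed by `0, …, n-1`). -/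
abbrev MultiTime (n : ℕ) : Type := Fin n → ℝ

/-- The partial derivative `∂f/∂x^i` of a function on the multi-time. -/
noncomputable def pd {n : ℕ} (i : Fin n) (f : MultiTime n → ℝ) (x : MultiTime n) : ℝ :=
  fderiv ℝ f x (Pi.single i 1)

/-- Second jets of scalar functions of `n` variables, with coordinates `u`, `u_k` and `u_{km}`,
the latter indexed by unordered pairs, so that `u_{km}` and `u_{mk}` are one and the same
coordinate. -/
structure Jet2 (n : ℕ) where
  /-- the coordinate `u` -/
  val : ℝ
  /-- the coordinates `u_k` -/
  d1 : Fin n → ℝ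
  /-- the coordinates `u_{km}` -/
  d2 : Sym2 (Fin n) → ℝ

/-- The second jet of a function at a point. Mixed second derivatives are taken in one fixed order,
which does not matter for functions of class `C²`, see `jet_d2_mk`. -/
noncomputable def jet {n : ℕ} (u : MultiTime n → ℝ) (x : MultiTime n) : Jet2 n where
  val := u x
  d1 := fun k => pd k u x
  d2 := fun s => pd s.inf (pd s.sup u) x

theorem pd_comm {n : ℕ} {u : MultiTime n → ℝ} {x : MultiTime n} (hu : ContDiffAt ℝ 2 u x)
    (k m : Fin n) : pd k (pd m u) x = pd m (pd k u) x := by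
  have hd : DifferentiableAt ℝ (fderiv ℝ u) x :=
    (hu.fderiv_right (m := 1) (by norm_num)).differentiableAt (by norm_num)
  have key : ∀ a b : Fin n, pd a (pd b u) x
      = fderiv ℝ (fderiv ℝ u) x (Pi.single a 1) (Pi.single b 1) := by
    intro a b
    have h := (hd.hasFDerivAt.clm_apply
      (hasFDerivAt_const (Pi.single b (1 : ℝ) : MultiTime n) x)).fderiv
    unfold pd
    rw [h]
    simp
  rw [key, key]
  exact (hu.isSymmSndFDerivAt (by simp)).eq _ _

/-- For functions of class `C²` the coordinate `u_{km}` of the jet is the mixed second partial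
derivative, in either order. -/
theorem jet_d2_mk {n : ℕ} {u : MultiTime n → ℝ} {x : MultiTime n} (hu : ContDiffAt ℝ 2 u x)
    (k m : Fin n) : (jet u x).d2 s(k, m) = pd k (pd m u) x := by
  rcases le_total k m with h | h
  · simp [jet, h]
  · simp [jet, h, pd_comm hu k m]

/-- A differential function depending on the second jet: a function of `u`, `u_k`, `u_{km}`. -/
abbrev DiffFun (n : ℕ) : Type := Jet2 n → ℝ

namespace DiffFun

/-- The function `F[u]` on the multi-time. Total derivatives `D_i` of differential functions are
evaluated on a field `u` as partial derivatives of such functions. -/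
noncomputable def on {n : ℕ} (F : DiffFun n) (u : MultiTime n → ℝ) : MultiTime n → ℝ :=
  fun x => F (jet u x)

/-- The partial derivative `∂F/∂u`. -/
noncomputable def du {n : ℕ} (F : DiffFun n) : DiffFun n :=
  fun J => deriv (fun t => F { J with val := t }) J.val

/-- The partial derivative `∂F/∂u_k`. -/
noncomputable def du1 {n : ℕ} (F : DiffFun n) (k : Fin n) : DiffFun n :=
  fun J => deriv (fun t => F { J with d1 := Function.update J.d1 k t }) (J.d1 k)

/-- The partial derivative `∂F/∂u_{km}`. -/
noncomputable def du2 {n : ℕ} (F : DiffFun n) (k m : Fin n) : DiffFun n :=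
  fun J => deriv (fun t => F { J with d2 := Function.update J.d2 s(k, m) t }) (J.d2 s(k, m))

end DiffFun

/-- The variational derivative `δF/δu` with respect to the pair of variables `x^i`, `x^j`,
evaluated on the field `u`:
`∂F/∂u - D_i ∂F/∂u_i - D_j ∂F/∂u_j + D_i² ∂F/∂u_{ii} + D_i D_j ∂F/∂u_{ij} + D_j² ∂F/∂u_{jj}`. -/
noncomputable def varD {n : ℕ} (F : DiffFun n) (i j : Fin n) (u : MultiTime n → ℝ) :
    MultiTime n → ℝ :=
  fun x => (F.du).on u x - pd i ((F.du1 i).on u) x - pd j ((F.du1 j).on u) x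
    + pd i (pd i ((F.du2 i i).on u)) x + pd i (pd j ((F.du2 i j).on u)) x
    + pd j (pd j ((F.du2 j j).on u)) x

/-- The variational derivative `δF/δu_k` with respect to the pair of variables `x^i`, `x^j`,
evaluated on the field `u`: `∂F/∂u_k - D_i ∂F/∂u_{ik} - D_j ∂F/∂u_{jk}`. -/
noncomputable def varD1 {n : ℕ} (F : DiffFun n) (i j k : Fin n) (u : MultiTime n → ℝ) :
    MultiTime n → ℝ :=
  fun x => (F.du1 k).on u x - pd i ((F.du2 i k).on u) x - pd j ((F.du2 j k).on u) x

/-- The variational derivative `δF/δu_{km} = ∂F/∂u_{km}`, evaluated on the field `u`. -/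
noncomputable def varD2 {n : ℕ} (F : DiffFun n) (k m : Fin n) (u : MultiTime n → ℝ) :
    MultiTime n → ℝ :=
  (F.du2 k m).on u

/-- The field `u` satisfies on `Ω` the system of multi-time Euler-Lagrange equations of the
pluri-Lagrangian problem with the 2-form `∑_{i<j} L_{ij}[u] dx^i ∧ dx^j`, `L_{ji} = -L_{ij}`. -/
structure MultiTimeEulerLagrange {n : ℕ} (L : Fin n → Fin n → DiffFun n)
    (u : MultiTime n → ℝ) (Ω : Set (MultiTime n)) : Prop where
  /-- `δL_{ij}/δu = 0` -/
  eq1 : ∀ i j, i ≠ j → ∀ x ∈ Ω, varD (L i j) i j u x = 0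
  /-- `δL_{ij}/δu_k = 0` for `k ∉ {i, j}` -/
  eq2 : ∀ i j k, i ≠ j → k ≠ i → k ≠ j → ∀ x ∈ Ω, varD1 (L i j) i j k u x = 0
  /-- `δL_{ij}/δu_{km} = 0` for `k, m ∉ {i, j}` -/
  eq3 : ∀ i j k m, i ≠ j → k ≠ i → k ≠ j → m ≠ i → m ≠ j →
    ∀ x ∈ Ω, varD2 (L i j) k m u x = 0
  /-- `δL_{ij}/δu_j = p_i` does not depend on `j ≠ i` -/
  eq4 : ∃ p : Fin n → MultiTime n → ℝ, ∀ i j, j ≠ i →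
    ∀ x ∈ Ω, varD1 (L i j) i j j u x = p i x
  /-- `δL_{ij}/δu_{jk} = p_i^k` does not depend on `j ≠ i`, for `k ≠ i` -/
  eq5 : ∃ p : Fin n → Fin n → MultiTime n → ℝ, ∀ i j k, j ≠ i → k ≠ i →
    ∀ x ∈ Ω, varD2 (L i j) j k u x = p i k x
  /-- `δL_{ij}/δu_{ij} + δL_{jk}/δu_{jk} + δL_{ki}/δu_{ki} = 0` for distinct `i, j, k` -/
  eq6 : ∀ i j k, i ≠ j → j ≠ k → k ≠ i → ∀ x ∈ Ω,
    varD2 (L i j) i j u x + varD2 (L j k) j k u x + varD2 (L k i) k i u x = 0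

/-- The coordinate 2-covector `dx^i ∧ dx^j`. -/
noncomputable def dxdx {n : ℕ} (i j : Fin n) : MultiTime n [⋀^Fin 2]→L[ℝ] ℝ where
  toFun v := v 0 i * v 1 j - v 0 j * v 1 i
  map_update_add' v k a b := by
    fin_cases k <;> simp [Function.update] <;> ring
  map_update_smul' v k c a := by
    fin_cases k <;> simp [Function.update] <;> ring
  map_eq_zero_of_eq' v k l h hkl := by
    have h01 : v 0 = v 1 := by
      fin_cases k <;> fin_cases l <;> simp_all
    simp [h01]
    ring
  cont := by fun_prop

@[simp]
theorem dxdx_apply {n : ℕ} (i j : Fin n) (v : Fin 2 → MultiTime n) :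
    dxdx i j v = v 0 i * v 1 j - v 0 j * v 1 i := rfl

/-- The 2-form `∑_{i<j} L_{ij}[u] dx^i ∧ dx^j` on the multi-time. -/
noncomputable def lagrangianForm {n : ℕ} (L : Fin n → Fin n → DiffFun n)
    (u : MultiTime n → ℝ) : MultiTime n → MultiTime n [⋀^Fin 2]→L[ℝ] ℝ :=
  fun x => ∑ i, ∑ j ∈ Finset.Ioi i, (L i j).on u x • dxdx i j

namespace SineGordon

/- Coordinates of the three-dimensional multi-time: `x`, `y`, `z` have the indices `0`, `1`, `2`. -/

/-- `L = ½ u_x u_y - cos u` -/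
noncomputable def L : DiffFun 3 := fun J =>
  1 / 2 * J.d1 0 * J.d1 1 - Real.cos J.val

/-- `M = ½ u_x u_z - ⅛ u_x⁴ + ½ u_xx²` -/
noncomputable def M : DiffFun 3 := fun J =>
  1 / 2 * J.d1 0 * J.d1 2 - 1 / 8 * J.d1 0 ^ 4 + 1 / 2 * J.d2 s(0, 0) ^ 2

/-- `N = ½ u_y u_z - ½ u_x² cos u - u_xx (u_xy - sin u)` -/
noncomputable def N : DiffFun 3 := fun J =>
  1 / 2 * J.d1 1 * J.d1 2 - 1 / 2 * J.d1 0 ^ 2 * Real.cos J.val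
    - J.d2 s(0, 0) * (J.d2 s(0, 1) - Real.sin J.val)

/-- The skew-symmetric array of coefficients: `L_{12} = L`, `L_{13} = M`, `L_{23} = -N`. -/
noncomputable def coeff : Fin 3 → Fin 3 → DiffFun 3 :=
  ![![0, L, M], ![-L, 0, -N], ![-M, N, 0]]

theorem coeff_antisymm (i j : Fin 3) : coeff i j = -coeff j i := by
  fin_cases i <;> fin_cases j <;> simp [coeff]

/-- The 2-form of the problem, `L dx ∧ dy - M dz ∧ dx - N dy ∧ dz`, along the field `u`. -/
noncomputable def form (u : MultiTime 3 → ℝ) : MultiTime 3 → MultiTime 3 [⋀^Fin 2]→L[ℝ] ℝ :=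
  fun x => L.on u x • dxdx 0 1 - M.on u x • dxdx 2 0 - N.on u x • dxdx 1 2

/-- The functions `coeff i j` are the coefficients of `form`. -/
theorem form_eq_lagrangianForm (u : MultiTime 3 → ℝ) : form u = lagrangianForm coeff u := by
  have h0 : Finset.Ioi (0 : Fin 3) = {1, 2} := by decide
  have h1 : Finset.Ioi (1 : Fin 3) = {2} := by decide
  have h2 : Finset.Ioi (2 : Fin 3) = ∅ := by decide
  funext x
  ext v
  simp [form, lagrangianForm, Fin.sum_univ_three, h0, h1, h2, coeff, DiffFun.on]
  ring

/-- The sine-Gordon equation `u_xy = sin u` at the point `x`. -/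
def SineGordonAt (u : MultiTime 3 → ℝ) (x : MultiTime 3) : Prop :=
  pd 0 (pd 1 u) x = Real.sin (u x)

/-- The modified KdV equation `u_z = u_xxx + ½ u_x³` at the point `x`. -/
def ModifiedKdVAt (u : MultiTime 3 → ℝ) (x : MultiTime 3) : Prop :=
  pd 2 u x = pd 0 (pd 0 (pd 0 u)) x + 1 / 2 * pd 0 u x ^ 3

end SineGordon

end PluriLagrangian

/-! Two entries of the system already carry both equations: `-N` is affine in `u_xx` with slope
`u_xy - sin u`, so equation 3 for the pair `(y, z)` is sine-Gordon; and equation 4 with `i = z`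
equates `-(½ u_z - ½ u_x³ - u_xxx)`, coming from `-M`, with `½ u_z`, coming from `N`, which is
modified KdV. Conversely, every other entry either holds identically or is a differential
consequence of these two; the deepest one is `δN/δu = 0`, an expression for `u_yz` proved in
`pd_one_pd_two`. For closedness, `dℒ` is `L_z - (M_y + N_x)` times the volume form, and
`pd_L_sub_pd_M_add_pd_N` factors this coefficient into a product of the two equations. -/

namespace PluriLagrangian

/-! ### Calculus of partial derivatives. -/

section PartialDerivatives

variable {n : ℕ} {f g : MultiTime n → ℝ} {x : MultiTime n}

theorem pd_const (i : Fin n) (c : ℝ) : pd i (fun _ => c) x = 0 := by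
  simp [pd]

theorem pd_neg (i : Fin n) : pd i (fun y => -f y) x = -pd i f x := by
  simp [pd, fderiv_fun_neg]

theorem pd_add (i : Fin n) (hf : DifferentiableAt ℝ f x) (hg : DifferentiableAt ℝ g x) :
    pd i (fun y => f y + g y) x = pd i f x + pd i g x := by
  simp [pd, fderiv_fun_add hf hg]

theorem pd_sub (i : Fin n) (hf : DifferentiableAt ℝ f x) (hg : DifferentiableAt ℝ g x) :
    pd i (fun y => f y - g y) x = pd i f x - pd i g x := by
  simp [pd, fderiv_fun_sub hf hg]

theorem pd_mul (i : Fin n) (hf : DifferentiableAt ℝ f x) (hg : DifferentiableAt ℝ g x) :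
    pd i (fun y => f y * g y) x = f x * pd i g x + g x * pd i f x := by
  simp [pd, fderiv_fun_mul hf hg]

theorem pd_pow (i : Fin n) (k : ℕ) (hf : DifferentiableAt ℝ f x) :
    pd i (fun y => f y ^ k) x = k * f x ^ (k - 1) * pd i f x := by
  simp [pd, fderiv_fun_pow k hf]

theorem pd_sin (i : Fin n) (hf : DifferentiableAt ℝ f x) :
    pd i (fun y => Real.sin (f y)) x = Real.cos (f x) * pd i f x := by
  simp [pd, fderiv_sin hf]

theorem pd_cos (i : Fin n) (hf : DifferentiableAt ℝ f x) :
    pd i (fun y => Real.cos (f y)) x = -(Real.sin (f x) * pd i f x) := by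
  simp [pd, fderiv_cos hf]

/-- On an open set a derivative sees only the germ, so an equation valid throughout `Ω` may be
differentiated. -/
theorem pd_congr_of_eqOn {Ω : Set (MultiTime n)} (hΩ : IsOpen Ω) (hfg : Set.EqOn f g Ω)
    (i : Fin n) : Set.EqOn (pd i f) (pd i g) Ω := by
  intro y hy
  simp only [pd]
  rw [(hfg.eventuallyEq_of_mem (hΩ.mem_nhds hy)).fderiv_eq]

theorem contDiffAt_pd (hf : ContDiffAt ℝ ∞ f x) (i : Fin n) : ContDiffAt ℝ ∞ (pd i f) x :=
  (hf.fderiv_right (m := ∞) (by simp)).clm_apply contDiffAt_const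

theorem pd_comm_of_smooth (hf : ContDiffAt ℝ ∞ f x) (i j : Fin n) :
    pd i (pd j f) x = pd j (pd i f) x :=
  pd_comm (hf.of_le (by norm_cast)) i j

theorem pd_pd_comm_of_smooth (hf : ContDiffAt ℝ ∞ f x) (i j k : Fin n) :
    pd i (pd j (pd k f)) x = pd j (pd k (pd i f)) x := by
  -- The inner swap is differentiated afterwards, so it must hold near `x`; being `C²` at a point, a
  -- finite order, persists on a neighbourhood.
  have h : pd i (pd k f) =ᶠ[nhds x] pd k (pd i f) := by
    filter_upwards [(hf.of_le (m := 2) (by norm_cast)).eventually (by simp)] with y hy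
    exact pd_comm hy i k
  rw [pd_comm_of_smooth (contDiffAt_pd hf k) i j]
  simp only [pd] at h ⊢
  rw [h.fderiv_eq]

end PartialDerivatives

namespace SineGordon

/-! ### The Lagrangians and their jet derivatives along a field. -/

section Jets

variable (u : MultiTime 3 → ℝ)

theorem L_on : L.on u = fun x => 1 / 2 * pd 0 u x * pd 1 u x - Real.cos (u x) := rfl

theorem M_on : M.on u = fun x => 1 / 2 * pd 0 u x * pd 2 u x - 1 / 8 * pd 0 u x ^ 4
    + 1 / 2 * pd 0 (pd 0 u) x ^ 2 := rfl

/-- Definitional because `inf` and `sup` of a concrete pair compute; this fixes `u_xy` as `pd 0 (pd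
1 u)`. -/
theorem N_on : N.on u = fun x => 1 / 2 * pd 1 u x * pd 2 u x
    - 1 / 2 * pd 0 u x ^ 2 * Real.cos (u x)
    - pd 0 (pd 0 u) x * (pd 0 (pd 1 u) x - Real.sin (u x)) := rfl

theorem du_neg_on {n : ℕ} (F : DiffFun n) (u : MultiTime n → ℝ) :
    (-F).du.on u = fun y => -F.du.on u y := by
  funext y; simp [DiffFun.du, DiffFun.on, deriv.fun_neg]

theorem du1_neg_on {n : ℕ} (F : DiffFun n) (k : Fin n) (u : MultiTime n → ℝ) :
    ((-F).du1 k).on u = fun y => -(F.du1 k).on u y := by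
  funext y; simp [DiffFun.du1, DiffFun.on, deriv.fun_neg]

theorem du2_neg_on {n : ℕ} (F : DiffFun n) (k m : Fin n) (u : MultiTime n → ℝ) :
    ((-F).du2 k m).on u = fun y => -(F.du2 k m).on u y := by
  funext y; simp [DiffFun.du2, DiffFun.on, deriv.fun_neg]

theorem varD_neg {n : ℕ} (F : DiffFun n) (i j : Fin n) (u : MultiTime n → ℝ) :
    varD (-F) i j u = -varD F i j u := by
  have hpd (k) (f : MultiTime n → ℝ) : pd k (fun y => -f y) = fun y => -pd k f y :=
    funext fun y => pd_neg k
  funext x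
  simp only [varD, du_neg_on, du1_neg_on, du2_neg_on, hpd, Pi.neg_apply]
  ring

theorem L_du : L.du.on u = fun x => Real.sin (u x) := by
  funext x; simp [DiffFun.du, DiffFun.on, L, jet]

theorem M_du : M.du.on u = fun _ => 0 := by
  funext x; simp [DiffFun.du, DiffFun.on, M, jet]

theorem N_du : N.du.on u = fun x => 1 / 2 * pd 0 u x ^ 2 * Real.sin (u x)
    + pd 0 (pd 0 u) x * Real.cos (u x) := by
  funext x
  have h : HasDerivAt (fun t => N { jet u x with val := t })
      (0 - 1 / 2 * (jet u x).d1 0 ^ 2 * (-Real.sin (u x))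
        - (jet u x).d2 s(0, 0) * (0 - Real.cos (u x))) (u x) :=
    ((hasDerivAt_const _ (1 / 2 * (jet u x).d1 1 * (jet u x).d1 2)).sub
      ((Real.hasDerivAt_cos _).const_mul (1 / 2 * (jet u x).d1 0 ^ 2))).sub
        (((hasDerivAt_const _ ((jet u x).d2 s(0, 1))).sub (Real.hasDerivAt_sin _)).const_mul
          ((jet u x).d2 s(0, 0)))
  refine h.deriv.trans ?_
  simp [jet]

theorem L_du1 (k : Fin 3) :
    (L.du1 k).on u = ![fun x => 1 / 2 * pd 1 u x, fun x => 1 / 2 * pd 0 u x, fun _ => 0] k := by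
  funext x
  fin_cases k <;> simp [DiffFun.du1, DiffFun.on, L, jet, Function.update]

theorem M_du1 (k : Fin 3) :
    (M.du1 k).on u = ![fun x => 1 / 2 * pd 2 u x - 1 / 2 * pd 0 u x ^ 3,
      fun _ => 0, fun x => 1 / 2 * pd 0 u x] k := by
  funext x
  fin_cases k
  · have h : HasDerivAt (fun t : ℝ => 1 / 2 * t * pd 2 u x - 1 / 8 * t ^ 4
        + 1 / 2 * pd 0 (pd 0 u) x ^ 2) (1 / 2 * 1 * pd 2 u x
          - 1 / 8 * ((4 : ℕ) * pd 0 u x ^ 3)) (pd 0 u x) :=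
      ((((hasDerivAt_id _).const_mul _).mul_const _).sub
        ((hasDerivAt_pow 4 _).const_mul _)).add_const _
    have h' := h.deriv
    simp [DiffFun.du1, DiffFun.on, M, jet, Function.update] at h' ⊢
    rw [h']; ring
  · simp [DiffFun.du1, DiffFun.on, M, jet, Function.update]
  · simp [DiffFun.du1, DiffFun.on, M, jet, Function.update]

theorem N_du1 (k : Fin 3) :
    (N.du1 k).on u = ![fun x => -(pd 0 u x * Real.cos (u x)), fun x => 1 / 2 * pd 2 u x,
      fun x => 1 / 2 * pd 1 u x] k := by
  funext x
  fin_cases k <;> simp [DiffFun.du1, DiffFun.on, N, jet, Function.update]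

theorem L_du2 (k m : Fin 3) : (L.du2 k m).on u = fun _ => 0 := by
  funext x; simp [DiffFun.du2, DiffFun.on, L, jet]

theorem M_du2 (k m : Fin 3) :
    (M.du2 k m).on u = if s(k, m) = s(0, 0) then pd 0 (pd 0 u) else fun _ => 0 := by
  funext x
  fin_cases k <;> fin_cases m <;> simp [DiffFun.du2, DiffFun.on, M, jet, Function.update]

theorem N_du2 (k m : Fin 3) :
    (N.du2 k m).on u = if s(k, m) = s(0, 0) then fun x => -(pd 0 (pd 1 u) x - Real.sin (u x))
      else if s(k, m) = s(0, 1) then fun x => -pd 0 (pd 0 u) x else fun _ => 0 := by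
  funext x
  fin_cases k <;> fin_cases m <;> simp [DiffFun.du2, DiffFun.on, N, jet, Function.update]

end Jets

/-! ### The factorised identity and the exterior derivative. -/

section Smooth

variable {u : MultiTime 3 → ℝ} {x : MultiTime 3}

/-- The identity `L_z - (M_y + N_x) = -(u_z - ½ u_x³ - u_xxx) (u_xy - sin u)`. -/
theorem pd_L_sub_pd_M_add_pd_N (hu : ContDiffAt ℝ ∞ u x) :
    pd 2 (L.on u) x - (pd 1 (M.on u) x + pd 0 (N.on u) x)
      = -(pd 2 u x - 1 / 2 * pd 0 u x ^ 3 - pd 0 (pd 0 (pd 0 u)) x)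
          * (pd 0 (pd 1 u) x - Real.sin (u x)) := by
  have d0 : DifferentiableAt ℝ u x := hu.differentiableAt (by simp)
  have d1 (i) : DifferentiableAt ℝ (pd i u) x := (contDiffAt_pd hu i).differentiableAt (by simp)
  have d2 (i j) : DifferentiableAt ℝ (pd i (pd j u)) x :=
    (contDiffAt_pd (contDiffAt_pd hu j) i).differentiableAt (by simp)
  rw [L_on, M_on, N_on]
  simp (disch := fun_prop) only [pd_sub, pd_add, pd_mul, pd_pow, pd_sin, pd_cos, pd_const]
  -- Mixed derivatives are put in one order, `x` outside `y` outside `z`, after which the identity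
  -- is polynomial.
  simp only [pd_comm_of_smooth hu 2 0, pd_comm_of_smooth hu 2 1, pd_comm_of_smooth hu 1 0,
    pd_pd_comm_of_smooth hu 1 0 0]
  push_cast
  ring

theorem fderiv_apply_eq_sum_pd {n : ℕ} (f : MultiTime n → ℝ) (x v : MultiTime n) :
    fderiv ℝ f x v = ∑ i, v i * pd i f x := by
  conv_lhs => rw [pi_eq_sum_univ' v]
  simp [pd]

theorem extDeriv_form_apply (hL : DifferentiableAt ℝ (L.on u) x)
    (hM : DifferentiableAt ℝ (M.on u) x) (hN : DifferentiableAt ℝ (N.on u) x)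
    (v : Fin 3 → MultiTime 3) :
    extDeriv (form u) x v
      = (pd 2 (L.on u) x - (pd 1 (M.on u) x + pd 0 (N.on u) x)) * (Matrix.of v).det := by
  have hform : DifferentiableAt ℝ (form u) x :=
    ((hL.smul_const _).sub (hM.smul_const _)).sub (hN.smul_const _)
  have key (w : Fin 2 → MultiTime 3) (i : Fin 3) : pd i (fun y => form u y w) x
      = pd i (L.on u) x * dxdx 0 1 w - pd i (M.on u) x * dxdx 2 0 w
        - pd i (N.on u) x * dxdx 1 2 w := by
    have hc (c : ℝ) : DifferentiableAt ℝ (fun _ : MultiTime 3 => c) x :=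
      differentiableAt_const c
    change pd i (fun y => L.on u y * dxdx 0 1 w - M.on u y * dxdx 2 0 w
      - N.on u y * dxdx 1 2 w) x = _
    rw [pd_sub i ((hL.fun_mul (hc _)).fun_sub (hM.fun_mul (hc _))) (hN.fun_mul (hc _)),
      pd_sub i (hL.fun_mul (hc _)) (hM.fun_mul (hc _)), pd_mul i hL (hc _), pd_mul i hM (hc _),
      pd_mul i hN (hc _)]
    simp only [pd_const]
    ring
  rw [extDeriv_apply hform]
  simp only [fderiv_apply_eq_sum_pd, key, Fin.sum_univ_three, dxdx_apply, Matrix.det_fin_three,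
    Fin.removeNth, Matrix.of_apply]
  simp [Fin.sum_univ_three, Fin.succAbove]
  ring

end Smooth
-- Equivalence of the Euler–Lagrange system with the two equations.
section EulerLagrange

variable {u : MultiTime 3 → ℝ} {Ω : Set (MultiTime 3)}

theorem sineGordonAt_of_eulerLagrange (h : MultiTimeEulerLagrange coeff u Ω)
    {x : MultiTime 3} (hx : x ∈ Ω) : SineGordonAt u x := by
  have h3 := h.eq3 1 2 0 0 (by decide) (by decide) (by decide) (by decide) (by decide) x hx
  simp [coeff, varD2, du2_neg_on, N_du2] at h3
  unfold SineGordonAt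
  linarith

theorem modifiedKdVAt_of_eulerLagrange (h : MultiTimeEulerLagrange coeff u Ω)
    {x : MultiTime 3} (hx : x ∈ Ω) : ModifiedKdVAt u x := by
  obtain ⟨p, hp⟩ := h.eq4
  have e := (hp 2 0 (by decide) x hx).trans (hp 2 1 (by decide) x hx).symm
  simp [coeff, varD1, du1_neg_on, du2_neg_on, pd_neg, M_du1, M_du2, N_du1, N_du2, pd_const] at e
  unfold ModifiedKdVAt
  linarith

theorem pd_modifiedKdV (hΩ : IsOpen Ω) (hu : ContDiffOn ℝ ∞ u Ω)
    (hK : ∀ x ∈ Ω, ModifiedKdVAt u x) (i : Fin 3) {x : MultiTime 3} (hx : x ∈ Ω) :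
    pd i (pd 2 u) x
      = pd i (pd 0 (pd 0 (pd 0 u))) x + 3 / 2 * pd 0 u x ^ 2 * pd i (pd 0 u) x := by
  have hs : ContDiffAt ℝ ∞ u x := hu.contDiffAt (hΩ.mem_nhds hx)
  have d1 : DifferentiableAt ℝ (pd 0 u) x := (contDiffAt_pd hs 0).differentiableAt (by simp)
  have d3 : DifferentiableAt ℝ (pd 0 (pd 0 (pd 0 u))) x :=
    (contDiffAt_pd (contDiffAt_pd (contDiffAt_pd hs 0) 0) 0).differentiableAt (by simp)
  have h : Set.EqOn (pd 2 u) (fun y => pd 0 (pd 0 (pd 0 u)) y + 1 / 2 * pd 0 u y ^ 3) Ω := hK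
  rw [pd_congr_of_eqOn hΩ h i hx]
  simp (disch := fun_prop) only [pd_add, pd_mul, pd_pow, pd_const]
  push_cast
  ring

theorem pd_sineGordon (hΩ : IsOpen Ω) (hu : ContDiffOn ℝ ∞ u Ω)
    (hS : ∀ x ∈ Ω, SineGordonAt u x) (i : Fin 3) {x : MultiTime 3} (hx : x ∈ Ω) :
    pd i (pd 0 (pd 1 u)) x = Real.cos (u x) * pd i u x := by
  have hs : ContDiffAt ℝ ∞ u x := hu.contDiffAt (hΩ.mem_nhds hx)
  have h : Set.EqOn (pd 0 (pd 1 u)) (fun y => Real.sin (u y)) Ω := hS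
  rw [pd_congr_of_eqOn hΩ h i hx, pd_sin i (hs.differentiableAt (by simp))]

/-- The consequence of both equations that expresses `u_yz` through derivatives in `x`. -/
theorem pd_one_pd_two (hΩ : IsOpen Ω) (hu : ContDiffOn ℝ ∞ u Ω)
    (hS : ∀ x ∈ Ω, SineGordonAt u x) (hK : ∀ x ∈ Ω, ModifiedKdVAt u x)
    {x : MultiTime 3} (hx : x ∈ Ω) :
    pd 1 (pd 2 u) x = 1 / 2 * pd 0 u x ^ 2 * Real.sin (u x)
      + pd 0 (pd 0 u) x * Real.cos (u x) := by
  have hs : ContDiffAt ℝ ∞ u x := hu.contDiffAt (hΩ.mem_nhds hx)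
  have d0 : DifferentiableAt ℝ u x := hs.differentiableAt (by simp)
  have d1 : DifferentiableAt ℝ (pd 0 u) x := (contDiffAt_pd hs 0).differentiableAt (by simp)
  -- `u_xxy = u_x cos u` is needed on all of `Ω`, since applying `D_x` once more gives the term
  -- `u_xxxy` of the `y`-derivative of modified KdV.
  have h : Set.EqOn (pd 1 (pd 0 (pd 0 u))) (fun y => Real.cos (u y) * pd 0 u y) Ω :=
    fun y hy => (pd_pd_comm_of_smooth (hu.contDiffAt (hΩ.mem_nhds hy)) 1 0 0).trans (pd_sineGordon hΩ hu hS 0 hy)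
  have hsg : pd 0 (pd 1 u) x = Real.sin (u x) := hS x hx
  rw [pd_modifiedKdV hΩ hu hK 1 hx,
    pd_comm_of_smooth (contDiffAt_pd (contDiffAt_pd hs 0) 0) 1 0, pd_congr_of_eqOn hΩ h 0 hx,
    pd_comm_of_smooth hs 1 0, hsg]
  simp (disch := fun_prop) only [pd_mul, pd_cos]
  ring

theorem eulerLagrange_of_sineGordon_of_modifiedKdV (hΩ : IsOpen Ω) (hu : ContDiffOn ℝ ∞ u Ω)
    (hS : ∀ x ∈ Ω, SineGordonAt u x) (hK : ∀ x ∈ Ω, ModifiedKdVAt u x) :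
    MultiTimeEulerLagrange coeff u Ω := by
  have hs {x} (hx : x ∈ Ω) : ContDiffAt ℝ ∞ u x := hu.contDiffAt (hΩ.mem_nhds hx)
  have d0 {x} (hx : x ∈ Ω) : DifferentiableAt ℝ u x := (hs hx).differentiableAt (by simp)
  have d1 {x} (hx : x ∈ Ω) (i) : DifferentiableAt ℝ (pd i u) x :=
    (contDiffAt_pd (hs hx) i).differentiableAt (by simp)
  have hsg {x} (hx : x ∈ Ω) : pd 0 (pd 1 u) x = Real.sin (u x) := hS x hx
  have hkdv {x} (hx : x ∈ Ω) : pd 2 u x = pd 0 (pd 0 (pd 0 u)) x + 1 / 2 * pd 0 u x ^ 3 :=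
    hK x hx
  -- An equality of functions, so that it also rewrites under the outer derivative in `D_i D_j`.
  have hzero (i : Fin 3) : pd i (fun _ => (0 : ℝ)) = fun _ : MultiTime 3 => 0 :=
    funext fun _ => pd_const i 0
  have varDL {x} (hx : x ∈ Ω) :
      varD L 0 1 u x = 0 ∧ varD L 1 0 u x = 0 := by
    have := d1 hx
    constructor <;> simp (disch := fun_prop) [varD, L_du, L_du1, L_du2, hzero, pd_mul, pd_const,
      pd_comm_of_smooth (hs hx) 1 0, hsg hx] <;> ring
  have varDM {x} (hx : x ∈ Ω) :
      varD M 0 2 u x = 0 ∧ varD M 2 0 u x = 0 := by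
    have := d1 hx
    -- `δM/δu` is minus the `x`-derivative of `u_z - u_xxx - ½ u_x³`.
    have h := pd_modifiedKdV hΩ hu hK 0 hx
    constructor <;> simp (disch := fun_prop) [varD, M_du, M_du1, M_du2, hzero, pd_sub, pd_mul,
      pd_pow, pd_const, pd_comm_of_smooth (hs hx) 2 0] <;> linarith
  have varDN {x} (hx : x ∈ Ω) :
      varD N 1 2 u x = 0 ∧ varD N 2 1 u x = 0 := by
    have := d1 hx
    have h := pd_one_pd_two hΩ hu hS hK hx
    constructor <;> simp (disch := fun_prop) [varD, N_du, N_du1, N_du2, hzero, pd_mul,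
      pd_const, pd_comm_of_smooth (hs hx) 2 1] <;> linarith
  refine ⟨?_, ?_, ?_, ?_, ?_, ?_⟩
  · intro i j hij x hx
    fin_cases i <;> fin_cases j <;>
      simp [coeff, varD_neg, varDL hx, varDM hx, varDN hx] at hij ⊢
  · intro i j k hij hki hkj x hx
    -- The one nontrivial case is `δN/δu_x = u_xxy - u_x cos u`.
    have h := pd_sineGordon hΩ hu hS 0 hx
    have h' := pd_pd_comm_of_smooth (hs hx) 1 0 0
    fin_cases i <;> fin_cases j <;> fin_cases k <;>
      simp [coeff, varD1, du1_neg_on, du2_neg_on, pd_neg, L_du1, L_du2, M_du1, M_du2, N_du1, N_du2, pd_const] at hij hki hkj ⊢ <;> linarith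
  · intro i j k m hij hki hkj hmi hmj x hx
    fin_cases i <;> fin_cases j <;> fin_cases k <;> simp at hij hki hkj <;>
      fin_cases m <;>
      simp [coeff, varD2, du2_neg_on, L_du2, M_du2, N_du2, hsg hx] at hmi hmj ⊢
  · refine ⟨![fun x => 1 / 2 * pd 0 u x, fun x => -(1 / 2 * pd 1 u x),
      fun x => 1 / 2 * pd 2 u x], ?_⟩
    intro i j hij x hx
    have h := hkdv hx
    fin_cases i <;> fin_cases j <;>
      simp [coeff, varD1, du1_neg_on, du2_neg_on, pd_neg, L_du1, L_du2, M_du1, M_du2, N_du1, N_du2, pd_const]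
        at hij ⊢
    -- Only `i = z`, `j = x` remains; there the value `½ u_z`, read off from `N`, is matched by
    -- modified KdV.
    linarith
  -- The condition singles out `i = z`, `k = x`, where `∂(-M)/∂u_xx` and `∂N/∂u_xy` are both
  -- `-u_xx`; all other entries vanish.
  · refine ⟨fun i k => if s(i, k) = s(2, 0) ∧ i = 2 then fun x => -pd 0 (pd 0 u) x
      else fun _ => 0, ?_⟩
    intro i j k hij hki x hx
    fin_cases i <;> fin_cases j <;> simp at hij <;> fin_cases k <;>
      simp [coeff, varD2, du2_neg_on, L_du2, M_du2, N_du2] at hki ⊢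
  · intro i j k hij hjk hki x hx
    fin_cases i <;> fin_cases j <;> simp at hij <;> fin_cases k <;>
      simp [coeff, varD2, du2_neg_on, L_du2, M_du2, N_du2] at hjk hki ⊢

end EulerLagrange

theorem extDeriv_form_eq_zero {u : MultiTime 3 → ℝ} {x : MultiTime 3}
    (hu : ContDiffAt ℝ ∞ u x) (hS : SineGordonAt u x) : extDeriv (form u) x = 0 := by
  have d0 : DifferentiableAt ℝ u x := hu.differentiableAt (by simp)
  have d1 (i) : DifferentiableAt ℝ (pd i u) x := (contDiffAt_pd hu i).differentiableAt (by simp)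
  have d2 (i j) : DifferentiableAt ℝ (pd i (pd j u)) x :=
    (contDiffAt_pd (contDiffAt_pd hu j) i).differentiableAt (by simp)
  have hsg : pd 0 (pd 1 u) x = Real.sin (u x) := hS
  ext v
  -- Sine-Gordon annihilates the second factor of the coefficient of the volume form.
  rw [extDeriv_form_apply (by rw [L_on]; fun_prop) (by rw [M_on]; fun_prop)
    (by rw [N_on]; fun_prop), pd_L_sub_pd_M_add_pd_N hu, hsg]
  simp

end SineGordon

end PluriLagrangian

theorem theorem3 (Ω : Set (PluriLagrangian.MultiTime 3)) (hΩ : IsOpen Ω)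
    (u : PluriLagrangian.MultiTime 3 → ℝ) (hu : ContDiffOn ℝ ∞ u Ω) :
    -- the multi-time Euler-Lagrange equations consist of sine-Gordon and modified KdV
    (PluriLagrangian.MultiTimeEulerLagrange PluriLagrangian.SineGordon.coeff u Ω ↔
      (∀ x ∈ Ω, PluriLagrangian.SineGordon.SineGordonAt u x) ∧
        (∀ x ∈ Ω, PluriLagrangian.SineGordon.ModifiedKdVAt u x)) ∧
    -- the 2-form is closed on simultaneous solutions
    ((∀ x ∈ Ω, PluriLagrangian.SineGordon.SineGordonAt u x) →
      (∀ x ∈ Ω, PluriLagrangian.SineGordon.ModifiedKdVAt u x) →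
        ∀ x ∈ Ω, extDeriv (PluriLagrangian.SineGordon.form u) x = 0) ∧
    -- `L_z - (M_y + N_x) = -(u_z - ½ u_x³ - u_xxx) (u_xy - sin u)` for every field `u`
    (∀ x ∈ Ω,
      PluriLagrangian.pd 2 (PluriLagrangian.SineGordon.L.on u) x
        - (PluriLagrangian.pd 1 (PluriLagrangian.SineGordon.M.on u) x
          + PluriLagrangian.pd 0 (PluriLagrangian.SineGordon.N.on u) x)
      = -(PluriLagrangian.pd 2 u x - 1 / 2 * PluriLagrangian.pd 0 u x ^ 3
            - PluriLagrangian.pd 0 (PluriLagrangian.pd 0 (PluriLagrangian.pd 0 u)) x)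
          * (PluriLagrangian.pd 0 (PluriLagrangian.pd 1 u) x - Real.sin (u x))) := by
  have hs {x} (hx : x ∈ Ω) : ContDiffAt ℝ ∞ u x := hu.contDiffAt (hΩ.mem_nhds hx)
  refine ⟨⟨fun h => ⟨?_, ?_⟩, fun h => ?_⟩, ?_, ?_⟩
  · exact fun x hx => PluriLagrangian.SineGordon.sineGordonAt_of_eulerLagrange h hx
  · exact fun x hx => PluriLagrangian.SineGordon.modifiedKdVAt_of_eulerLagrange h hx
  · exact PluriLagrangian.SineGordon.eulerLagrange_of_sineGordon_of_modifiedKdV hΩ hu h.1 h.2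
  · exact fun hS _ x hx =>
      PluriLagrangian.SineGordon.extDeriv_form_eq_zero (hs hx) (hS x hx)
  · exact fun x hx => PluriLagrangian.SineGordon.pd_L_sub_pd_M_add_pd_N (hs hx)
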